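/- All graphs are finite and simple. A graph is 1-planar if it can be drawn in the plane with every edge crossed at most once; it is optimal 1-planar if it is 1-planar and has $n\ge 3$ vertices and $4n-8$ edges. For $k\ge 3$ the extended wheel graph $XW_{2k}$ consists of a cycle of length $2k$, the edges between vertices at distance two on the cycle, and two non-adjacent poles, each adjacent to every vertex of the cycle. The two (feasible) reductions of a graph $G$ are the following; their results are taken up to isomorphism. SR: let $x$ be a vertex of degree six with neighbours $x_1,\dots,x_6$ such that $x_1x_2,\,x_2x_3,\dots,x_5x_6,\,x_6x_1$ and $x_1x_3,\,x_3x_5,\,x_5x_1$ are edges and $x_2x_4,\ x_6x_4,\ x_1x_4$ are not edges. Remove $x$ and the edge $x_3x_5$, and add the edges $x_4x_1,\ x_4x_2,\ x_4x_6$. CR: let $x_1,\dots,x_4,v_1,\dots,v_4$ be distinct vertices such that, with indices modulo $4$, the neighbours of $x_i$ are exactly the other three $x_j$ and $v_{i-1},v_i,v_{i+1}$, each $v_iv_{i+1}$ is an edge, and $v_1v_3,\ v_2v_4$ are not edges. Remove $x_1,\dots,x_4$ and add the edges $v_1v_3,\ v_2v_4$. The reduction system with a given set of rules on a class $\mathcal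 C$ of graphs has a step $G\to G'$ whenever $G,G'\in\mathcal C$ and $G'$ is obtained from $G$ by one of the rules; $\to^*$ is the reflexive transitive closure. The system is confluent if $X\to^* U$ and $X\to^* W$ always imply that $U$ and $W$ have, up to isomorphism, a common descendant $Z$, that is, $U\to^* Z$ and $W\to^* Z$. A graph is irreducible for a set of rules if none of the rules can be applied to it. Corollary. (1) The reduction system with the rules $\{SR,CR\}$ on the optimal 1-planar graphs is not confluent. (2) The reduction system with the single rule $SR$ on the 5-connected optimal 1-planar graphs is not confluent. Moreover, in each of the two systems there is a graph $G$ of the class with $G\to^* XW_{2k}$ and $G\to^* XW_{2l}$ for two non-isomorphic extended wheel graphs $XW_{2k}$, $XW_{2l}$ ($k,l\ge 3$) that are irreducible for the rules of the system. -/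

import Mathlib

open Set

namespace OnePlanarReduction

/-- A finite simple undirected graph. -/
structure FinGraph where
  V : Type
  finite : Finite V
  graph : SimpleGraph V

/-- Two finite graphs are isomorphic. -/
def FinGraph.Iso (G H : FinGraph) : Prop := Nonempty (G.graph ≃g H.graph)

/-- A drawing of `G` in the plane: distinct vertices are placed at distinct points, every edge `e`
is drawn as a simple curve `curve e` (parametrized by `[0, 1]`) that joins the points of its two
ends, and no edge passes through a vertex in its interior. The values of `curve` on pairs that are
not edges play no role. -/
structure IsDrawing {V : Type} (G : SimpleGraph V) (pos : V → ℝ × ℝ)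
    (curve : Sym2 V → ℝ → ℝ × ℝ) : Prop where
  pos_injective : Function.Injective pos
  continuousOn : ∀ e ∈ G.edgeSet, ContinuousOn (curve e) (Icc 0 1)
  injOn : ∀ e ∈ G.edgeSet, InjOn (curve e) (Icc 0 1)
  ends : ∀ e ∈ G.edgeSet, s(curve e 0, curve e 1) = Sym2.map pos e
  interior : ∀ e ∈ G.edgeSet, ∀ t ∈ Ioo (0 : ℝ) 1, ∀ v : V, curve e t ≠ pos v

/-- The crossings on the edge `e` in a drawing: the pairs `(f, P)` of another edge `f` and
a point `P` that is interior to both curves. -/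
def crossings {V : Type} (G : SimpleGraph V) (curve : Sym2 V → ℝ → ℝ × ℝ) (e : Sym2 V) :
    Set (Sym2 V × (ℝ × ℝ)) :=
  {c | c.1 ∈ G.edgeSet ∧ c.1 ≠ e ∧ c.2 ∈ curve e '' Ioo 0 1 ∧ c.2 ∈ curve c.1 '' Ioo 0 1}

/-- `G` can be drawn in the plane so that every edge is crossed at most once. -/
def IsOnePlanar {V : Type} (G : SimpleGraph V) : Prop :=
  ∃ (pos : V → ℝ × ℝ) (curve : Sym2 V → ℝ → ℝ × ℝ),
    IsDrawing G pos curve ∧ ∀ e ∈ G.edgeSet, (crossings G curve e).Subsingleton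

/-- Optimal 1-planar graphs: 1-planar graphs with `n ≥ 3` vertices and `4 n - 8` edges. -/
def IsOptimalOnePlanar (G : FinGraph) : Prop :=
  IsOnePlanar G.graph ∧ 3 ≤ Nat.card G.V ∧ G.graph.edgeSet.ncard + 8 = 4 * Nat.card G.V

/-- `k`-connectivity: there are more than `k` vertices, and the removal of fewer than `k` vertices
never disconnects the graph. -/
def IsVertexConnected (k : ℕ) (G : FinGraph) : Prop :=
  k < Nat.card G.V ∧ ∀ S : Set G.V, S.ncard < k → (G.graph.induce Sᶜ).Connected

/-- The 5-connected optimal 1-planar graphs. -/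
def IsFiveConnectedOptimal (G : FinGraph) : Prop :=
  IsOptimalOnePlanar G ∧ IsVertexConnected 5 G

/-- The extended wheel graph `XW_{2k}` (meant for `k ≥ 3`): a cycle of length `2k` (`Sum.inl i`),
the edges between vertices at distance two on the cycle, and two non-adjacent poles
(`Sum.inr b`) that are adjacent to all vertices of the cycle. -/
def extendedWheelGraph (k : ℕ) : SimpleGraph (Fin (2 * k) ⊕ Bool) :=
  SimpleGraph.fromRel fun a b =>
    match a, b with
    | Sum.inl i, Sum.inl j => j.val = (i.val + 1) % (2 * k) ∨ j.val = (i.val + 2) % (2 * k)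
    | Sum.inl _, Sum.inr _ => True
    | Sum.inr _, _ => False

/-- `XW_{2k}` as a finite graph. -/
def XW (k : ℕ) : FinGraph where
  V := Fin (2 * k) ⊕ Bool
  finite := inferInstance
  graph := extendedWheelGraph k

/-- The crossed star `CS` is matched at `x`: the vertex `x` has exactly the six neighbours
`y 0, …, y 5` (so `x` has degree six), which form a hexagon in this circular order, and
`y 0, y 2, y 4` form a triangle. In the embedding, `x` is the common vertex of the three kites
`(x, y 0, y 1, y 2)`, `(x, y 2, y 3, y 4)`, `(x, y 4, y 5, y 0)`; the edges from `x` to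
`y 0, y 2, y 4` are planar and those to `y 1, y 3, y 5` are crossed by the edges of the triangle. -/
structure IsCrossedStar {V : Type} (G : SimpleGraph V) (x : V) (y : Fin 6 → V) : Prop where
  injective : Function.Injective y
  neighbors : G.neighborSet x = range y
  hexagon : ∀ i, G.Adj (y i) (y (i + 1))
  triangle : G.Adj (y 0) (y 2) ∧ G.Adj (y 2) (y 4) ∧ G.Adj (y 4) (y 0)

/-- Feasibility of `SR(x ↦ y 3)`: there is no blocking red edge and no blocking black edge. -/
def SRFeasible {V : Type} (G : SimpleGraph V) (y : Fin 6 → V) : Prop :=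
  ¬ G.Adj (y 1) (y 3) ∧ ¬ G.Adj (y 5) (y 3) ∧ ¬ G.Adj (y 0) (y 3)

/-- The result of `SR(x ↦ y 3)`: `x` is removed (merged with `y 3`) and the three kites are replaced
by the two kites `(y 3, y 0, y 1, y 2)` and `(y 3, y 4, y 5, y 0)`. So the edge `y 2 y 4`
disappears and `y 3` gets the new neighbours `y 0, y 1, y 5`. -/
def srResult {V : Type} (G : SimpleGraph V) (x : V) (y : Fin 6 → V) :
    SimpleGraph ↥({x}ᶜ : Set V) :=
  ((G \ SimpleGraph.edge (y 2) (y 4)) ⊔ SimpleGraph.edge (y 3) (y 0) ⊔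
    SimpleGraph.edge (y 3) (y 1) ⊔ SimpleGraph.edge (y 3) (y 5)).induce {x}ᶜ

/-- `G` reduces to `H` by a feasible `SR`-reduction (`H` is determined up to isomorphism). -/
def SRStep (G H : FinGraph) : Prop :=
  ∃ (x : G.V) (y : Fin 6 → G.V), IsCrossedStar G.graph x y ∧ SRFeasible G.graph y ∧
    Nonempty (H.graph ≃g srResult G.graph x y)

/-- The crossed cube `CC` is matched with inner cycle `x 0, …, x 3` and outer cycle `v 0, …, v 3`:
the inner vertices have degree six, `x i` is adjacent to the other three inner vertices and
to `v (i - 1), v i, v (i + 1)`, and consecutive vertices of the outer cycle are adjacent. -/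
structure IsCrossedCube {V : Type} (G : SimpleGraph V) (x v : Fin 4 → V) : Prop where
  injective_inner : Function.Injective x
  injective_outer : Function.Injective v
  disjoint : Disjoint (range x) (range v)
  neighbors : ∀ i, G.neighborSet (x i) =
    {x (i + 1), x (i + 2), x (i + 3)} ∪ {v (i - 1), v i, v (i + 1)}
  outer : ∀ i, G.Adj (v i) (v (i + 1))

/-- Feasibility of `CR(x 0, x 1, x 2, x 3)`: the diagonals of the outer cycle are missing. -/
def CRFeasible {V : Type} (G : SimpleGraph V) (v : Fin 4 → V) : Prop :=
  ¬ G.Adj (v 0) (v 2) ∧ ¬ G.Adj (v 1) (v 3)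

/-- The result of `CR(x 0, x 1, x 2, x 3)`: the inner cycle is removed and the outer cycle becomes
a kite. -/
def crResult {V : Type} (G : SimpleGraph V) (x v : Fin 4 → V) :
    SimpleGraph ↥((range x)ᶜ : Set V) :=
  (G ⊔ SimpleGraph.edge (v 0) (v 2) ⊔ SimpleGraph.edge (v 1) (v 3)).induce (range x)ᶜ

/-- `G` reduces to `H` by a feasible `CR`-reduction (`H` is determined up to isomorphism). -/
def CRStep (G H : FinGraph) : Prop :=
  ∃ x v : Fin 4 → G.V, IsCrossedCube G.graph x v ∧ CRFeasible G.graph v ∧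
    Nonempty (H.graph ≃g crResult G.graph x v)

/-- One step of the system with the two rules `SR` and `CR`. -/
def SRCRStep (G H : FinGraph) : Prop := SRStep G H ∨ CRStep G H

/-- The reduction system `step` on the class `C` of graphs: `G` and `H` both belong to `C`. -/
def stepOn (C : FinGraph → Prop) (step : FinGraph → FinGraph → Prop) (G H : FinGraph) : Prop :=
  C G ∧ C H ∧ step G H

/-- A graph is irreducible if no reduction step applies to it. -/
def IsIrreducible (step : FinGraph → FinGraph → Prop) (G : FinGraph) : Prop :=
  ∀ H, ¬ step G H

/-- Confluence of a graph reduction system; as usual for graphs, the common descendant is only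
required to be common up to isomorphism. -/
def IsConfluent (step : FinGraph → FinGraph → Prop) : Prop :=
  ∀ X U W : FinGraph, Relation.ReflTransGen step X U → Relation.ReflTransGen step X W →
    ∃ Z Z' : FinGraph, Relation.ReflTransGen step U Z ∧ Relation.ReflTransGen step W Z' ∧ Z.Iso Z'

end OnePlanarReduction

/-!
A graph on 13 vertices, obtained from `XW_8` by undoing three `SR`-steps, can also be reduced to
`XW_{10}` by one `SR`-step. Extended wheel graphs are irreducible: two adjacent vertices have at
least three common neighbours, whereas the centre and the target of a feasible `SR` have only two,
and the poles dominate all other vertices, which leaves no room for a crossed cube. Two irreducible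
descendants that are not isomorphic refute confluence.

All graphs on the two reduction paths belong to the class. They are unions of kites drawn on the
integer lattice, where signed areas decide which edges cross. For 5-connectivity, an `SR`-step is
the contraction of an edge followed by the removal of an edge, so connectivity lifts from the result
to the original graph as long as its degrees are large enough, and extended wheel graphs are
5-connected because a separation avoiding the poles cuts the cycle in two places, each time in two
consecutive vertices.
-/

namespace OnePlanarReduction

section PolygonalCurves

/-- Twice the signed area of the triangle `p q r`. -/
def signedArea {R : Type*} [CommRing R] (p q r : R × R) : R :=
  (q.1 - p.1) * (r.2 - p.2) - (q.2 - p.2) * (r.1 - p.1)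

variable {R S : Type*} [CommRing R] [CommRing S]

theorem signedArea_map (f : R →+* S) (p q r : R × R) :
    signedArea (p.map f f) (q.map f f) (r.map f f) = f (signedArea p q r) := by
  simp [signedArea]

theorem signedArea_self_right (p q : R × R) : signedArea p q q = 0 := by
  simp only [signedArea]; ring

theorem signedArea_lineMap (p q r s : R × R) (t : R) :
    signedArea p q (AffineMap.lineMap r s t) =
      (1 - t) * signedArea p q r + t * signedArea p q s := by
  simp only [signedArea, AffineMap.lineMap_apply_module, Prod.fst_add, Prod.snd_add, Prod.smul_fst,
    Prod.smul_snd, smul_eq_mul]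
  ring

theorem signedArea_lineMap_self (p q : R × R) (t : R) :
    signedArea p q (AffineMap.lineMap p q t) = 0 := by
  simp only [signedArea, AffineMap.lineMap_apply_module, Prod.fst_add, Prod.snd_add, Prod.smul_fst,
    Prod.smul_snd, smul_eq_mul]
  ring

/-- The curve from `p` to `q` over the parameter interval `[0, 1]` along which an edge is drawn:
a segment, or two segments that meet in a bend. -/
noncomputable def bentCurve (p q : ℝ × ℝ) : Option (ℝ × ℝ) → ℝ → ℝ × ℝ
  | none => AffineMap.lineMap p q
  | some m => fun t =>
      if t ≤ 1 / 2 then AffineMap.lineMap p m (2 * t) else AffineMap.lineMap m q (2 * t - 1)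

theorem bentCurve_zero (p q : ℝ × ℝ) (m : Option (ℝ × ℝ)) : bentCurve p q m 0 = p := by
  cases m <;> simp [bentCurve]

theorem bentCurve_one (p q : ℝ × ℝ) (m : Option (ℝ × ℝ)) : bentCurve p q m 1 = q := by
  cases m with
  | none => simp [bentCurve]
  | some m => norm_num [bentCurve]

theorem continuous_bentCurve (p q : ℝ × ℝ) (m : Option (ℝ × ℝ)) :
    Continuous (bentCurve p q m) := by
  cases m with
  | none => exact AffineMap.lineMap_continuous
  | some m =>
    refine Continuous.if_le (AffineMap.lineMap_continuous.comp (by fun_prop))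
      (AffineMap.lineMap_continuous.comp (by fun_prop)) continuous_id continuous_const ?_
    rintro t rfl
    norm_num

theorem bentCurve_none_injective {p q : ℝ × ℝ} (h : p ≠ q) :
    Function.Injective (bentCurve p q none) :=
  AffineMap.lineMap_injective ℝ h

theorem bentCurve_some_injective {p q m : ℝ × ℝ} (h : signedArea p m q ≠ 0) :
    Function.Injective (bentCurve p q (some m)) := by
  have hpm : p ≠ m := by rintro rfl; simp [signedArea] at h
  have hmq : m ≠ q := by rintro rfl; exact h (signedArea_self_right p m)
  have halves_ne (t u : ℝ) (hu : ¬ u ≤ 1 / 2) :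
      AffineMap.lineMap p m (2 * t) ≠ AffineMap.lineMap m q (2 * u - 1) := by
    intro heq
    have harea := congrArg (signedArea p m) heq
    rw [signedArea_lineMap_self, signedArea_lineMap, signedArea_self_right, mul_zero, zero_add]
      at harea
    have hu' : 2 * u - 1 = 0 := (mul_eq_zero.1 harea.symm).resolve_right h
    exact hu (by linarith)
  intro t u htu
  simp only [bentCurve] at htu
  split_ifs at htu with ht hu hu
  · linarith [AffineMap.lineMap_injective ℝ hpm htu]
  · exact (halves_ne _ _ hu htu).elim
  · exact (halves_ne _ _ ht htu.symm).elim
  · linarith [AffineMap.lineMap_injective ℝ hmq htu]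

end PolygonalCurves

section IntegerSegments

/-- A segment between lattice points. -/
abbrev LatticeSegment := (ℤ × ℤ) × (ℤ × ℤ)

/-- A lattice point as a point of the plane. -/
def toPlane (p : ℤ × ℤ) : ℝ × ℝ := p.map (Int.castRingHom ℝ) (Int.castRingHom ℝ)

theorem toPlane_injective : Function.Injective toPlane :=
  Prod.map_injective.2 ⟨Int.cast_injective, Int.cast_injective⟩

theorem signedArea_toPlane (p q r : ℤ × ℤ) :
    signedArea (toPlane p) (toPlane q) (toPlane r) = ((signedArea p q r : ℤ) : ℝ) :=
  signedArea_map (Int.castRingHom ℝ) p q r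

/-- The points of the plane on a lattice segment. -/
def LatticeSegment.points (A : LatticeSegment) : Set (ℝ × ℝ) :=
  AffineMap.lineMap (toPlane A.1) (toPlane A.2) '' Icc (0 : ℝ) 1

theorem LatticeSegment.signedArea_eq_zero_of_mem_points {A : LatticeSegment} {P : ℝ × ℝ}
    (hP : P ∈ A.points) : signedArea (toPlane A.1) (toPlane A.2) P = 0 := by
  obtain ⟨t, _, rfl⟩ := hP
  exact signedArea_lineMap_self _ _ _

theorem LatticeSegment.subsingleton_inter_points {A B : LatticeSegment}
    (h : signedArea A.1 A.2 B.1 ≠ signedArea A.1 A.2 B.2) :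
    (A.points ∩ B.points).Subsingleton := by
  rintro P ⟨hPA, t, -, rfl⟩ Q ⟨hQA, u, -, rfl⟩
  have ht := signedArea_eq_zero_of_mem_points hPA
  have hu := signedArea_eq_zero_of_mem_points hQA
  rw [signedArea_lineMap, signedArea_toPlane, signedArea_toPlane] at ht hu
  have hne : ((signedArea A.1 A.2 B.1 : ℤ) : ℝ) - (signedArea A.1 A.2 B.2 : ℤ) ≠ 0 :=
    sub_ne_zero.2 (by exact_mod_cast h)
  rw [mul_right_cancel₀ hne (by linarith : t * _ = u * _)]

/-- The segment `B` lies strictly on one side of the line through `A`, except that one end of `B`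
may lie on that line if it is one of the points `pos v`. -/
def LatticeSegment.IsBeside {V : Type*} (pos : V → ℤ × ℤ) (A B : LatticeSegment) : Prop :=
  0 < signedArea A.1 A.2 B.1 * signedArea A.1 A.2 B.2 ∨
  (signedArea A.1 A.2 B.1 = 0 ∧ signedArea A.1 A.2 B.2 ≠ 0 ∧ ∃ v, pos v = B.1) ∨
  (signedArea A.1 A.2 B.2 = 0 ∧ signedArea A.1 A.2 B.1 ≠ 0 ∧ ∃ v, pos v = B.2)

instance {V : Type*} [Fintype V] (pos : V → ℤ × ℤ) (A B : LatticeSegment) :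
    Decidable (A.IsBeside pos B) := by
  unfold LatticeSegment.IsBeside; infer_instance

theorem convexCombination_ne_zero_of_mul_pos {K : Type*} [Field K] [LinearOrder K]
    [IsStrictOrderedRing K] {a b t : K} (hab : 0 < a * b) (ht : t ∈ Icc 0 1) :
    (1 - t) * a + t * b ≠ 0 := by
  intro h
  have key : (1 - t) * a ^ 2 + t * (a * b) = 0 := by linear_combination a * h
  have ha : 0 < a ^ 2 := by
    have := left_ne_zero_of_mul hab.ne'
    positivity
  rcases ht.1.eq_or_lt with rfl | ht0
  · simp [ha.ne'] at key
  · linarith [mul_pos ht0 hab, mul_nonneg (sub_nonneg.2 ht.2) ha.le]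

theorem LatticeSegment.IsBeside.exists_eq_toPlane {V : Type*} {pos : V → ℤ × ℤ}
    {A B : LatticeSegment} (h : A.IsBeside pos B) {P : ℝ × ℝ} (hA : P ∈ A.points)
    (hB : P ∈ B.points) : ∃ v, P = toPlane (pos v) := by
  obtain ⟨t, ht, rfl⟩ := hB
  have harea := signedArea_eq_zero_of_mem_points hA
  rw [signedArea_lineMap, signedArea_toPlane, signedArea_toPlane] at harea
  rcases h with hpos | ⟨h₁, h₂, v, hv⟩ | ⟨h₂, h₁, v, hv⟩
  · exact (convexCombination_ne_zero_of_mul_pos (by exact_mod_cast hpos) ht harea).elim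
  · have : t = 0 := by simpa [h₁, h₂] using harea
    exact ⟨v, by simp [this, hv]⟩
  · have : 1 - t = 0 := by simpa [h₁, h₂] using harea
    exact ⟨v, by simp [show t = 1 by linarith, hv]⟩

end IntegerSegments

section LatticeLayouts

theorem mk_inf_sup {α : Type*} [LinearOrder α] (e : Sym2 α) : s(e.inf, e.sup) = e :=
  Sym2.sortEquiv.symm_apply_apply e

/-- A polygonal drawing of a graph on the lattice: `pos` places the vertices and `bend` puts at most
one bend on each edge. -/
structure LatticeLayout (V : Type) where
  pos : V → ℤ × ℤ
  bend : Sym2 V → Option (ℤ × ℤ)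

namespace LatticeLayout

variable {V : Type} [LinearOrder V] (D : LatticeLayout V)

/-- The curve along which the edge `e` is drawn, from its smaller to its larger end. -/
noncomputable def curve (e : Sym2 V) : ℝ → ℝ × ℝ :=
  bentCurve (toPlane (D.pos e.inf)) (toPlane (D.pos e.sup)) ((D.bend e).map toPlane)

theorem curve_zero (e : Sym2 V) : D.curve e 0 = toPlane (D.pos e.inf) :=
  bentCurve_zero _ _ _

theorem curve_one (e : Sym2 V) : D.curve e 1 = toPlane (D.pos e.sup) :=
  bentCurve_one _ _ _

/-- The one or two segments of which the curve of the edge `e` consists. -/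
def pieces (e : Sym2 V) : List LatticeSegment :=
  match D.bend e with
  | none => [(D.pos e.inf, D.pos e.sup)]
  | some m => [(D.pos e.inf, m), (m, D.pos e.sup)]

theorem exists_piece (e : Sym2 V) {t : ℝ} (ht : t ∈ Icc (0 : ℝ) 1) :
    ∃ A ∈ D.pieces e, D.curve e t ∈ A.points := by
  obtain ⟨ht₀, ht₁⟩ := ht
  unfold pieces curve
  cases D.bend e with
  | none => exact ⟨_, List.mem_singleton_self _, t, ⟨ht₀, ht₁⟩, rfl⟩
  | some m =>
    by_cases h : t ≤ 1 / 2
    · refine ⟨(D.pos e.inf, m), by simp, 2 * t, ⟨by linarith, by linarith⟩, ?_⟩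
      simp only [Option.map_some, bentCurve, if_pos h]
    · refine ⟨(m, D.pos e.sup), by simp, 2 * t - 1, ⟨by linarith, by linarith⟩, ?_⟩
      simp only [Option.map_some, bentCurve, if_neg h]

variable [Fintype V]

/-- The pairs of a segment of `e` and a segment of another edge in the list `E` that are not
separated by the line through one of them; they are recorded together with the other edge. -/
def meetings (E : List (Sym2 V)) (e : Sym2 V) :
    List (LatticeSegment × Sym2 V × LatticeSegment) :=
  (D.pieces e).flatMap fun A => (E.filter (· ≠ e)).flatMap fun f =>
    ((D.pieces f).filter fun B => ¬ (A.IsBeside D.pos B ∨ B.IsBeside D.pos A)).map (A, f, ·)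

theorem mem_meetings {E : List (Sym2 V)} {e f : Sym2 V} {A B : LatticeSegment} :
    (A, f, B) ∈ D.meetings E e ↔ (A ∈ D.pieces e ∧ (f ∈ E ∧ f ≠ e) ∧ B ∈ D.pieces f ∧
      ¬ (A.IsBeside D.pos B ∨ B.IsBeside D.pos A)) := by
  simp only [meetings, List.mem_flatMap, List.mem_map, List.mem_filter, decide_eq_true_eq,
    Prod.mk.injEq]
  grind

/-- A decidable condition under which the edges in the list `E` are drawn by `D` in such a way that
each of them is crossed at most once. -/
structure IsOnePlanarOn (E : List (Sym2 V)) : Prop where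
  pos_injective : Function.Injective D.pos
  bend_proper : ∀ e ∈ E, ∀ m ∈ D.bend e, signedArea (D.pos e.inf) m (D.pos e.sup) ≠ 0
  avoids_vertices : ∀ e ∈ E, ∀ v, v ∉ e → ∀ A ∈ D.pieces e, signedArea A.1 A.2 (D.pos v) ≠ 0
  meetings_subsingleton : ∀ e ∈ E, ∀ c ∈ D.meetings E e, ∀ d ∈ D.meetings E e, c = d
  meetings_transversal : ∀ e ∈ E, ∀ c ∈ D.meetings E e,
    signedArea c.1.1 c.1.2 c.2.2.1 ≠ signedArea c.1.1 c.1.2 c.2.2.2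

set_option synthInstance.maxSize 256 in
instance (E : List (Sym2 V)) : Decidable (D.IsOnePlanarOn E) :=
  decidable_of_iff (_ ∧ _ ∧ _ ∧ _ ∧ _)
    ⟨fun ⟨hinj, hbend, havoid, hsub, htrans⟩ => ⟨hinj, hbend, havoid, hsub, htrans⟩,
      fun ⟨hinj, hbend, havoid, hsub, htrans⟩ => ⟨hinj, hbend, havoid, hsub, htrans⟩⟩

variable {D} {E : List (Sym2 V)}

theorem IsOnePlanarOn.curve_injective (h : D.IsOnePlanarOn E) {e : Sym2 V} (he : e ∈ E)
    (hdiag : ¬ e.IsDiag) : Function.Injective (D.curve e) := by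
  have hne : e.inf ≠ e.sup := by rwa [← mk_inf_sup e, Sym2.mk_isDiag_iff] at hdiag
  unfold curve
  cases hm : D.bend e with
  | none => exact bentCurve_none_injective ((toPlane_injective.comp h.pos_injective).ne hne)
  | some m =>
    refine bentCurve_some_injective ?_
    rw [signedArea_toPlane]
    exact_mod_cast h.bend_proper e he m hm

theorem IsOnePlanarOn.isDrawing (h : D.IsOnePlanarOn E) {G : SimpleGraph V}
    (hG : ∀ e ∈ G.edgeSet, e ∈ E) : IsDrawing G (toPlane ∘ D.pos) D.curve where
  pos_injective := toPlane_injective.comp h.pos_injective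
  continuousOn _ _ := (continuous_bentCurve _ _ _).continuousOn
  injOn e he := (h.curve_injective (hG e he) (G.not_isDiag_of_mem_edgeSet he)).injOn
  ends e _ := by
    conv_rhs => rw [← mk_inf_sup e]
    rw [curve_zero, curve_one, Sym2.map_mk, Function.comp_apply, Function.comp_apply]
  interior e he t ht v hv := by
    have hinj := h.curve_injective (hG e he) (G.not_isDiag_of_mem_edgeSet he)
    by_cases hve : v ∈ e
    · rw [← mk_inf_sup e, Sym2.mem_iff] at hve
      rcases hve with rfl | rfl
      · exact ht.1.ne' (hinj (hv.trans (D.curve_zero e).symm))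
      · exact ht.2.ne (hinj (hv.trans (D.curve_one e).symm))
    · obtain ⟨A, hA, hP⟩ := D.exists_piece e (Ioo_subset_Icc_self ht)
      have harea := LatticeSegment.signedArea_eq_zero_of_mem_points hP
      rw [hv, Function.comp_apply, signedArea_toPlane] at harea
      exact h.avoids_vertices e (hG e he) v hve A hA (by exact_mod_cast harea)

/-- Interior points of two curves are not vertices, so they can only coincide at a meeting, and
each meeting contributes at most one point. -/
theorem IsOnePlanarOn.isOnePlanar (h : D.IsOnePlanarOn E) {G : SimpleGraph V}
    (hG : ∀ e ∈ G.edgeSet, e ∈ E) : IsOnePlanar G := by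
  have hD := h.isDrawing hG
  refine ⟨_, _, hD, fun e he => ?_⟩
  have exists_meeting (c) (hc : c ∈ crossings G D.curve e) :
      ∃ A B, (A, c.1, B) ∈ D.meetings E e ∧ c.2 ∈ A.points ∧ c.2 ∈ B.points := by
    obtain ⟨f, P⟩ := c
    obtain ⟨hf, hfe, ⟨t, ht, rfl⟩, u, hu, htu⟩ := hc
    obtain ⟨A, hA, hPA⟩ := D.exists_piece e (Ioo_subset_Icc_self ht)
    obtain ⟨B, hB, hPB⟩ := D.exists_piece f (Ioo_subset_Icc_self hu)
    simp only at htu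
    rw [htu] at hPB
    refine ⟨A, B, D.mem_meetings.2 ⟨hA, ⟨hG f hf, hfe⟩, hB, fun hbeside => ?_⟩, hPA, hPB⟩
    obtain ⟨v, hv⟩ : ∃ v, D.curve e t = toPlane (D.pos v) :=
      hbeside.elim (·.exists_eq_toPlane hPA hPB) (·.exists_eq_toPlane hPB hPA)
    exact hD.interior e he t ht v hv
  rintro ⟨f, P⟩ hP ⟨g, Q⟩ hQ
  obtain ⟨A, B, hAB, hPA, hPB⟩ := exists_meeting _ hP
  obtain ⟨A', B', hAB', hQA, hQB⟩ := exists_meeting _ hQ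
  obtain ⟨rfl, rfl, rfl⟩ : A = A' ∧ f = g ∧ B = B' := by
    simpa using h.meetings_subsingleton e (hG e he) _ hAB _ hAB'
  have hPQ : P = Q := LatticeSegment.subsingleton_inter_points
    (h.meetings_transversal e (hG e he) _ hAB) ⟨hPA, hPB⟩ ⟨hQA, hQB⟩
  rw [hPQ]

end LatticeLayout

end LatticeLayouts

section Kites

/-- The four vertices, in cyclic order, of a kite: a quadrangle with two crossing diagonals. -/
abbrev Kite (V : Type) := V × V × V × V

namespace Kite

variable {V : Type}

/-- Incidence of a vertex and a kite. -/
def Mem (v : V) (K : Kite V) : Prop :=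
  v = K.1 ∨ v = K.2.1 ∨ v = K.2.2.1 ∨ v = K.2.2.2

instance [DecidableEq V] (v : V) (K : Kite V) : Decidable (K.Mem v) :=
  inferInstanceAs (Decidable (_ ∨ _))

/-- The four sides and the two diagonals of a kite. -/
def edges (K : Kite V) : List (Sym2 V) :=
  [s(K.1, K.2.1), s(K.2.1, K.2.2.1), s(K.2.2.1, K.2.2.2), s(K.2.2.2, K.1), s(K.1, K.2.2.1),
    s(K.2.1, K.2.2.2)]

theorem Mem.mk_mem_edges {K : Kite V} {a b : V} (ha : K.Mem a) (hb : K.Mem b) (hab : a ≠ b) :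
    s(a, b) ∈ K.edges := by
  obtain ⟨p, q, r, s⟩ := K
  rcases ha with rfl | rfl | rfl | rfl <;> rcases hb with rfl | rfl | rfl | rfl <;>
    first | exact (hab rfl).elim | simp [edges]

end Kite

/-- The union of the kites in a list. The kites of an optimal 1-planar graph cover all its edges. -/
def kiteGraph {V : Type} (Ks : List (Kite V)) : SimpleGraph V where
  Adj a b := a ≠ b ∧ ∃ K ∈ Ks, K.Mem a ∧ K.Mem b
  symm := ⟨fun _ _ ⟨hab, K, hK, ha, hb⟩ => ⟨hab.symm, K, hK, hb, ha⟩⟩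
  loopless := ⟨fun _ h => h.1 rfl⟩

instance {V : Type} [DecidableEq V] (Ks : List (Kite V)) : DecidableRel (kiteGraph Ks).Adj :=
  fun _ _ => inferInstanceAs (Decidable (_ ∧ _))

theorem mem_flatMap_edges_of_mem_edgeSet {V : Type} {Ks : List (Kite V)} {e : Sym2 V}
    (he : e ∈ (kiteGraph Ks).edgeSet) : e ∈ Ks.flatMap Kite.edges := by
  induction e with
  | h a b =>
    obtain ⟨hab, K, hK, ha, hb⟩ := he
    exact List.mem_flatMap.2 ⟨K, hK, ha.mk_mem_edges hb hab⟩

theorem isOptimalOnePlanar_of_le_kiteGraph {V : Type} [LinearOrder V] [Fintype V]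
    {G : SimpleGraph V} [DecidableRel G.Adj] {Ks : List (Kite V)} {D : LatticeLayout V}
    (hG : G ≤ kiteGraph Ks) (hD : D.IsOnePlanarOn (Ks.flatMap Kite.edges))
    (hcard : 3 ≤ Fintype.card V) (hdeg : ∑ v, G.degree v + 16 = 8 * Fintype.card V) :
    IsOptimalOnePlanar ⟨V, inferInstance, G⟩ := by
  refine ⟨hD.isOnePlanar fun e he => mem_flatMap_edges_of_mem_edgeSet
    (SimpleGraph.edgeSet_mono hG he), by rwa [Nat.card_eq_fintype_card], ?_⟩
  rw [Nat.card_eq_fintype_card, ← SimpleGraph.coe_edgeFinset, ncard_coe_finset]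
  rw [SimpleGraph.sum_degrees_eq_twice_card_edges] at hdeg
  change G.edgeFinset.card + 8 = 4 * Fintype.card V
  omega

/-- The layout with its vertices at `pos` in which the diagonals of the outer kite `(w, s, e, n)`,
whose vertices are meant to lie at `(±8, 0)` and `(0, ±8)`, run around the outside. -/
def outerKiteLayout {V : Type} [DecidableEq V] (pos : V → ℤ × ℤ) : Kite V → LatticeLayout V
  | (w, s, e, n) =>
    { pos := pos
      bend := fun f =>
        if f = s(w, e) then some (0, 24) else if f = s(s, n) then some (24, 0) else none }

end Kites

section Connectivity

/-- Two disjoint nonempty sets of vertices without edges between them. The graph is `k`-connected if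
at least `k` vertices lie outside any such pair. -/
structure IsSeparation {V : Type*} (G : SimpleGraph V) (A B : Set V) : Prop where
  nonempty_left : A.Nonempty
  nonempty_right : B.Nonempty
  disjoint : Disjoint A B
  not_adj : ∀ a ∈ A, ∀ b ∈ B, ¬ G.Adj a b

theorem IsSeparation.symm {V : Type*} {G : SimpleGraph V} {A B : Set V}
    (h : IsSeparation G A B) : IsSeparation G B A where
  nonempty_left := h.nonempty_right
  nonempty_right := h.nonempty_left
  disjoint := h.disjoint.symm
  not_adj b hb a ha hba := h.not_adj a ha b hb hba.symm

theorem IsSeparation.not_connected {V : Type*} {G : SimpleGraph V} {A B : Set V}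
    (h : IsSeparation G A B) : ¬ (G.induce (A ∪ B)).Connected := by
  intro hconn
  obtain ⟨a, ha⟩ := h.nonempty_left
  obtain ⟨b, hb⟩ := h.nonempty_right
  obtain ⟨p⟩ := hconn.preconnected ⟨a, .inl ha⟩ ⟨b, .inr hb⟩
  obtain ⟨d, -, hfst, hsnd⟩ :=
    p.exists_boundary_dart (Subtype.val ⁻¹' A) ha (h.disjoint.notMem_of_mem_right hb)
  exact h.not_adj _ hfst _ (d.snd.2.resolve_left hsnd) d.adj

theorem exists_isSeparation_of_not_connected {V : Type*} {G : SimpleGraph V} {T : Set V}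
    (hT : T.Nonempty) (h : ¬ (G.induce T).Connected) :
    ∃ A B, IsSeparation G A B ∧ A ∪ B = T := by
  have : Nonempty T := hT.to_subtype
  obtain ⟨u, v, huv⟩ : ∃ u v, ¬ (G.induce T).Reachable u v := by
    simpa [SimpleGraph.connected_iff, SimpleGraph.Preconnected] using h
  let R : Set T := {w | (G.induce T).Reachable u w}
  refine ⟨Subtype.val '' R, Subtype.val '' Rᶜ, ⟨⟨u, u, .refl u, rfl⟩, ⟨v, v, huv, rfl⟩, ?_, ?_⟩, ?_⟩
  · exact (disjoint_image_iff Subtype.val_injective).2 disjoint_compl_right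
  · rintro _ ⟨a, ha, rfl⟩ _ ⟨b, hb, rfl⟩ hab
    exact hb (ha.trans (SimpleGraph.Adj.reachable (G := G.induce T) hab))
  · rw [← image_union, union_compl_self, image_univ, Subtype.range_coe]

theorem isVertexConnected_iff {k : ℕ} {G : FinGraph} :
    IsVertexConnected k G ↔
      k < Nat.card G.V ∧ ∀ A B, IsSeparation G.graph A B → k ≤ (A ∪ B)ᶜ.ncard := by
  have := G.finite
  refine and_congr_right fun hcard => ⟨fun h A B hAB => ?_, fun h S hS => ?_⟩
  · by_contra! hlt
    exact hAB.not_connected (compl_compl (A ∪ B) ▸ h _ hlt)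
  · by_contra hconn
    have hne : Sᶜ.Nonempty := by
      rw [nonempty_compl]
      rintro rfl
      rw [ncard_univ] at hS
      exact lt_asymm hS hcard
    obtain ⟨A, B, hAB, hunion⟩ := exists_isSeparation_of_not_connected hne hconn
    have := h A B hAB
    rw [hunion, compl_compl] at this
    exact this.not_gt hS

variable {V W : Type*} {G : SimpleGraph V} {H : SimpleGraph W} {π : V → W} {A B : Set V} {x z : V}

theorem IsSeparation.pushforward (h : IsSeparation G A B) (hπ : Function.Surjective π)
    (hlift : ∀ p q, H.Adj p q → ∃ u v, π u = p ∧ π v = q ∧ G.Adj u v)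
    (hA : (kernImage π A).Nonempty) (hB : (kernImage π B).Nonempty) :
    IsSeparation H (kernImage π A) (kernImage π B) where
  nonempty_left := hA
  nonempty_right := hB
  disjoint := by
    refine Set.disjoint_left.2 fun p hpA hpB => ?_
    obtain ⟨u, rfl⟩ := hπ p
    exact Set.disjoint_left.1 h.disjoint (hpA rfl) (hpB rfl)
  not_adj p hp q hq hpq := by
    obtain ⟨u, v, rfl, rfl, huv⟩ := hlift p q hpq
    exact h.not_adj u (hp rfl) v (hq rfl) huv

theorem IsSeparation.compl_kernImage_subset (h : IsSeparation G A B)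
    (hfiber : ∀ u v, π u = π v → u = v ∨ G.Adj u v) :
    (kernImage π A ∪ kernImage π B)ᶜ ⊆ π '' (A ∪ B)ᶜ := by
  intro p hp
  simp only [mem_compl_iff, mem_union, not_or, kernImage, mem_ofPred_eq, not_forall] at hp
  obtain ⟨⟨u, rfl, huA⟩, v, hvu, hvB⟩ := hp
  by_cases huB : u ∈ B
  · refine ⟨v, fun hv => ?_, hvu⟩
    have hvA := hv.resolve_right hvB
    rcases hfiber v u hvu with rfl | hadj
    exacts [huA hvA, h.not_adj v hvA u huB hadj]
  · exact ⟨u, fun hu => hu.elim huA huB, rfl⟩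

theorem IsSeparation.neighborSet_subset_of_kernImage_eq_empty (h : IsSeparation G A B)
    (hfiber : ∀ u v, π u = π v → u = v ∨ s(u, v) = s(x, z)) (hA : kernImage π A = ∅) :
    ∃ a, G.neighborSet a ⊆ (A ∪ B)ᶜ := by
  have exists_mate (a) (ha : a ∈ A) : ∃ u ∉ A, s(u, a) = s(x, z) := by
    have : π a ∉ kernImage π A := hA ▸ notMem_empty _
    simp only [kernImage, mem_ofPred_eq, not_forall] at this
    obtain ⟨u, hua, hu⟩ := this
    exact ⟨u, hu, (hfiber u a hua).resolve_left (by rintro rfl; exact hu ha)⟩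
  obtain ⟨a, ha⟩ := h.nonempty_left
  obtain ⟨u, hu, hua⟩ := exists_mate a ha
  refine ⟨a, fun b hab hb => hb.elim (fun hbA => ?_) fun hbB => h.not_adj a ha b hbB hab⟩
  obtain ⟨v, _, hvb⟩ := exists_mate b hbA
  rcases Sym2.eq_iff.1 (hua.trans hvb.symm) with ⟨-, rfl⟩ | ⟨rfl, -⟩
  exacts [G.irrefl hab, hu hbA]

/-- A separation of `G` induces one of the contraction, unless one of its sides is `x` or `z` alone;
then all neighbours of that vertex lie outside the separation. -/
theorem IsVertexConnected.of_contraction {k : ℕ} {G H : FinGraph} {π : G.V → H.V} {x z : G.V}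
    (hH : IsVertexConnected k H) (hdeg : ∀ v, k ≤ (G.graph.neighborSet v).ncard)
    (hxz : G.graph.Adj x z) (hπ : Function.Surjective π)
    (hlift : ∀ p q, H.graph.Adj p q → ∃ u v, π u = p ∧ π v = q ∧ G.graph.Adj u v)
    (hfiber : ∀ u v, π u = π v → u = v ∨ s(u, v) = s(x, z)) : IsVertexConnected k G := by
  have := G.finite
  have := H.finite
  rw [isVertexConnected_iff] at hH ⊢
  refine ⟨hH.1.trans_le (Nat.card_le_card_of_surjective π hπ), fun A B hAB => ?_⟩
  have le_of_neighborSet (h : ∃ a, G.graph.neighborSet a ⊆ (A ∪ B)ᶜ) : k ≤ (A ∪ B)ᶜ.ncard :=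
    let ⟨a, ha⟩ := h
    (hdeg a).trans (ncard_le_ncard ha)
  rcases (kernImage π A).eq_empty_or_nonempty with hA | hA
  · exact le_of_neighborSet (hAB.neighborSet_subset_of_kernImage_eq_empty hfiber hA)
  rcases (kernImage π B).eq_empty_or_nonempty with hB | hB
  · rw [union_comm] at le_of_neighborSet ⊢
    exact le_of_neighborSet (hAB.symm.neighborSet_subset_of_kernImage_eq_empty hfiber hB)
  have hclique (u v) (huv : π u = π v) : u = v ∨ G.graph.Adj u v :=
    (hfiber u v huv).imp_right fun he => by
      rwa [← SimpleGraph.mem_edgeSet, he]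
  calc k ≤ (kernImage π A ∪ kernImage π B)ᶜ.ncard := hH.2 _ _ (hAB.pushforward hπ hlift hA hB)
    _ ≤ (π '' (A ∪ B)ᶜ).ncard := ncard_le_ncard (hAB.compl_kernImage_subset hclique)
    _ ≤ (A ∪ B)ᶜ.ncard := ncard_image_le

theorem IsCrossedStar.adj {V : Type} {G : SimpleGraph V} {x : V} {y : Fin 6 → V}
    (h : IsCrossedStar G x y) (i : Fin 6) : G.Adj x (y i) := by
  rw [← SimpleGraph.mem_neighborSet, h.neighbors]
  exact mem_range_self i

theorem IsCrossedStar.adj_or_of_srResult_adj {V : Type} {G : SimpleGraph V} {x : V}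
    {y : Fin 6 → V} (h : IsCrossedStar G x y) {p q : ↥({x}ᶜ : Set V)}
    (hpq : (srResult G x y).Adj p q) :
    G.Adj p q ∨ (y 3 = p ∧ G.Adj x q) ∨ (y 3 = q ∧ G.Adj p x) := by
  simp only [srResult, SimpleGraph.comap_adj, SimpleGraph.sup_adj, SimpleGraph.sdiff_adj,
    SimpleGraph.edge_adj, Function.Embedding.subtype_apply] at hpq
  have := h.adj
  grind [SimpleGraph.Adj.symm]

/-- An `SR`-step contracts the edge from `x` to `y 3` and then removes an edge. -/
theorem IsVertexConnected.of_srStep {k : ℕ} {G H : FinGraph} (hH : IsVertexConnected k H)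
    (h : SRStep G H) (hdeg : ∀ v, k ≤ (G.graph.neighborSet v).ncard) : IsVertexConnected k G := by
  classical
  obtain ⟨x, y, hxy, -, ⟨φ⟩⟩ := h
  let merge (v : G.V) : ↥({x}ᶜ : Set G.V) :=
    if hv : v = x then ⟨y 3, (hxy.adj 3).ne'⟩ else ⟨v, hv⟩
  have val_merge (v) : (merge v : G.V) = if v = x then y 3 else v := by
    simp only [merge]; split_ifs <;> rfl
  have merge_self (p : ↥({x}ᶜ : Set G.V)) (hp : y 3 = p) : merge x = p := by simp [merge, hp]
  have merge_coe (v : ↥({x}ᶜ : Set G.V)) : merge v = v := by simp [merge, show ↑v ≠ x from v.2]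
  refine hH.of_contraction (π := φ.symm ∘ merge) hdeg (hxy.adj 3) ?_ (fun p q hpq => ?_)
    (fun u v huv => ?_)
  · exact φ.symm.surjective.comp fun v => ⟨v, merge_coe v⟩
  · obtain ⟨u, v, hu, hv, huv⟩ : ∃ u v, merge u = φ p ∧ merge v = φ q ∧ G.graph.Adj u v := by
      rcases hxy.adj_or_of_srResult_adj (φ.map_adj_iff.2 hpq) with hadj | ⟨hp, hadj⟩ | ⟨hq, hadj⟩
      · exact ⟨φ p, φ q, merge_coe _, merge_coe _, hadj⟩
      · exact ⟨x, φ q, merge_self _ hp, merge_coe _, hadj⟩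
      · exact ⟨φ p, x, merge_coe _, merge_self _ hq, hadj⟩
    exact ⟨u, v, by simp [hu], by simp [hv], huv⟩
  · have hmerge := congrArg Subtype.val (φ.symm.injective huv)
    rw [val_merge, val_merge] at hmerge
    grind

end Connectivity

section ExtendedWheels

theorem IsSeparation.exists_mem_next_two_notMem {V : Type*} {G : SimpleGraph V} {A B : Set V}
    (h : IsSeparation G A B) {ρ : ℕ → V} (hadj₁ : ∀ d, G.Adj (ρ d) (ρ (d + 1)))
    (hadj₂ : ∀ d, G.Adj (ρ d) (ρ (d + 2))) {a b : ℕ} (hab : a ≤ b) (ha : ρ a ∈ A)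
    (hb : ρ b ∈ B) : ∃ d, ρ d ∈ A ∧ ρ (d + 1) ∉ A ∪ B ∧ ρ (d + 2) ∉ A ∪ B := by
  classical
  set d := Nat.findGreatest (ρ · ∈ A) b
  have hd : ρ d ∈ A := Nat.findGreatest_spec (P := (ρ · ∈ A)) hab ha
  have hdb : d ≠ b := fun hdb => Set.disjoint_left.1 h.disjoint (hdb ▸ hd) hb
  have hdb' : d + 1 ≠ b := fun hdb' => h.not_adj _ hd _ hb (hdb' ▸ hadj₁ d)
  have hle : d ≤ b := Nat.findGreatest_le b
  have hmax (e) (hde : d < e) (heb : e ≤ b) : ρ e ∉ A := Nat.findGreatest_is_greatest hde heb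
  refine ⟨d, hd, not_or.2 ⟨?_, ?_⟩, not_or.2 ⟨?_, ?_⟩⟩
  · exact hmax _ (by omega) (by omega)
  · exact fun hB => h.not_adj _ hd _ hB (hadj₁ d)
  · exact hmax _ (by omega) (by omega)
  · exact fun hB => h.not_adj _ hd _ hB (hadj₂ d)

variable {k : ℕ}

theorem extendedWheelGraph_adj_inl_inl {i j : Fin (2 * k)} :
    (extendedWheelGraph k).Adj (.inl i) (.inl j) ↔ i ≠ j ∧
      ((j.val = (i.val + 1) % (2 * k) ∨ j.val = (i.val + 2) % (2 * k)) ∨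
        (i.val = (j.val + 1) % (2 * k) ∨ i.val = (j.val + 2) % (2 * k))) :=
  and_congr_left' Sum.inl_injective.ne_iff

theorem extendedWheelGraph_adj_inl_inr (i : Fin (2 * k)) (b : Bool) :
    (extendedWheelGraph k).Adj (.inl i) (.inr b) :=
  ⟨Sum.inl_ne_inr, .inl trivial⟩

theorem not_extendedWheelGraph_adj_inr_inr (b c : Bool) :
    ¬ (extendedWheelGraph k).Adj (.inr b) (.inr c) :=
  fun h => h.2.elim id id

instance (k : ℕ) : DecidableRel (extendedWheelGraph k).Adj
  | .inl _, .inl _ => decidable_of_iff _ extendedWheelGraph_adj_inl_inl.symm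
  | .inl i, .inr b => isTrue (extendedWheelGraph_adj_inl_inr i b)
  | .inr b, .inl i => isTrue (extendedWheelGraph_adj_inl_inr i b).symm
  | .inr b, .inr c => isFalse (not_extendedWheelGraph_adj_inr_inr b c)

/-- The vertices of the cycle of `XW_{2k}`, numbered periodically. -/
def rim (k : ℕ) [NeZero k] (d : ℕ) : Fin (2 * k) ⊕ Bool :=
  .inl (Fin.ofNat (2 * k) d)

theorem rim_eq_rim_iff [NeZero k] {d e : ℕ} : rim k d = rim k e ↔ d ≡ e [MOD 2 * k] :=
  Sum.inl_injective.eq_iff.trans Fin.ext_iff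

theorem rim_val [NeZero k] (i : Fin (2 * k)) : rim k i = .inl i :=
  congrArg Sum.inl (Fin.ofNat_val_eq_self i)

theorem extendedWheelGraph_adj_rim_inr [NeZero k] (d : ℕ) (b : Bool) :
    (extendedWheelGraph k).Adj (rim k d) (.inr b) :=
  extendedWheelGraph_adj_inl_inr _ _

theorem rim_ne_rim_add [NeZero k] (d : ℕ) {j : ℕ} (hj₀ : j ≠ 0) (hj : j < 2 * k) :
    rim k d ≠ rim k (d + j) := by
  rw [Ne, rim_eq_rim_iff, Nat.ModEq.comm, Nat.add_modEq_left_iff]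
  exact Nat.not_dvd_of_pos_of_lt (Nat.pos_of_ne_zero hj₀) hj

theorem extendedWheelGraph_adj_rim_add [NeZero k] (hk : 3 ≤ k) (d : ℕ) {j : ℕ}
    (hj : j = 1 ∨ j = 2) : (extendedWheelGraph k).Adj (rim k d) (rim k (d + j)) :=
  ⟨rim_ne_rim_add d (by omega) (by omega), by
    rcases hj with rfl | rfl <;> simp [rim]⟩

theorem IsSeparation.five_le_ncard_of_inr_mem {A B : Set (Fin (2 * k) ⊕ Bool)} (hk : 3 ≤ k)
    (h : IsSeparation (extendedWheelGraph k) A B) {b : Bool} (hb : .inr b ∈ A) :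
    5 ≤ (A ∪ B)ᶜ.ncard := by
  have inl_notMem_right (i) : .inl i ∉ B := fun hi =>
    h.not_adj _ hb _ hi (extendedWheelGraph_adj_inl_inr i b).symm
  have inl_notMem_left (i) : .inl i ∉ A := by
    obtain ⟨j | c, hc⟩ := h.nonempty_right
    · exact (inl_notMem_right j hc).elim
    · exact fun hi => h.not_adj _ hi _ hc (extendedWheelGraph_adj_inl_inr i c)
  have hsub : range Sum.inl ⊆ (A ∪ B)ᶜ := by
    rintro _ ⟨i, rfl⟩
    exact not_or.2 ⟨inl_notMem_left i, inl_notMem_right i⟩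
  have hcard : (range (Sum.inl : Fin (2 * k) → Fin (2 * k) ⊕ Bool)).ncard = 2 * k := by
    rw [← image_univ, ncard_image_of_injective _ Sum.inl_injective, ncard_univ, Nat.card_fin]
  linarith [ncard_le_ncard hsub]

theorem IsSeparation.exists_rim_mem_next_two_notMem [NeZero k] {A B : Set (Fin (2 * k) ⊕ Bool)}
    (hk : 3 ≤ k) (h : IsSeparation (extendedWheelGraph k) A B) (hpole : ∀ b, .inr b ∉ A ∪ B) :
    ∃ d, rim k d ∈ A ∧ rim k (d + 1) ∉ A ∪ B ∧ rim k (d + 2) ∉ A ∪ B := by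
  have exists_rim_mem (C : Set (Fin (2 * k) ⊕ Bool)) (hC : C.Nonempty) (hsub : C ⊆ A ∪ B) :
      ∃ d < 2 * k, rim k d ∈ C := by
    obtain ⟨i | b, hv⟩ := hC
    exacts [⟨i, i.2, rim_val i ▸ hv⟩, (hpole b (hsub hv)).elim]
  have hadj (j) (hj : j = 1 ∨ j = 2) (d) := extendedWheelGraph_adj_rim_add hk d hj
  obtain ⟨a, ha, haA⟩ := exists_rim_mem A h.nonempty_left subset_union_left
  obtain ⟨b, _, hbB⟩ := exists_rim_mem B h.nonempty_right subset_union_right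
  have hperiod : rim k (b + 2 * k) = rim k b := rim_eq_rim_iff.2 (Nat.add_modEq_right ..)
  exact h.exists_mem_next_two_notMem (hadj 1 (.inl rfl)) (hadj 2 (.inr rfl))
    (by omega : a ≤ b + 2 * k) haA (hperiod ▸ hbB)

theorem IsSeparation.five_le_ncard_of_inr_notMem {A B : Set (Fin (2 * k) ⊕ Bool)} (hk : 3 ≤ k)
    (h : IsSeparation (extendedWheelGraph k) A B) (hpole : ∀ b, .inr b ∉ A ∪ B) :
    5 ≤ (A ∪ B)ᶜ.ncard := by
  have : NeZero k := ⟨by omega⟩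
  obtain ⟨d, hdA, hd₁, hd₂⟩ := h.exists_rim_mem_next_two_notMem hk hpole
  obtain ⟨e, heB, he₁, -⟩ := h.symm.exists_rim_mem_next_two_notMem hk (union_comm A B ▸ hpole)
  have rim_succ_injective {m n : ℕ} (hmn : rim k (m + 1) = rim k (n + 1)) : rim k m = rim k n :=
    rim_eq_rim_iff.2 (Nat.ModEq.add_right_cancel' 1 (rim_eq_rim_iff.1 hmn))
  have hne₁ : rim k (d + 1) ≠ rim k (e + 1) := fun heq =>
    Set.disjoint_left.1 h.disjoint hdA (rim_succ_injective heq ▸ heB)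
  have hne₂ : rim k (d + 2) ≠ rim k (e + 1) := fun heq =>
    hd₁ (.inr (rim_succ_injective heq ▸ heB))
  have hne₃ : rim k (d + 1) ≠ rim k (d + 2) := rim_ne_rim_add (d + 1) one_ne_zero (by omega)
  let T : Finset (Fin (2 * k) ⊕ Bool) :=
    {.inr false, .inr true, rim k (d + 1), rim k (d + 2), rim k (e + 1)}
  have hT : T.card = 5 := by
    have inr_ne_rim (b) (n) : .inr b ≠ rim k n := Sum.inr_ne_inl
    simp [T, Finset.card_insert_of_notMem, inr_ne_rim, hne₁, hne₂, hne₃]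
  have hsub : ↑T ⊆ (A ∪ B)ᶜ := by
    rw [union_comm B A] at he₁
    simp [T, insert_subset_iff, hpole, hd₁, hd₂, he₁, -mem_union, -compl_union]
  rw [← hT, ← ncard_coe_finset]
  exact ncard_le_ncard hsub

theorem isVertexConnected_XW (hk : 3 ≤ k) : IsVertexConnected 5 (XW k) := by
  refine isVertexConnected_iff.2 ⟨?_, fun A B h => ?_⟩
  · simp only [XW, Nat.card_eq_fintype_card, Fintype.card_sum, Fintype.card_fin, Fintype.card_bool]
    omega
  · by_cases hpole : ∃ b, .inr b ∈ A ∪ B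
    · obtain ⟨b, hb | hb⟩ := hpole
      · exact h.five_le_ncard_of_inr_mem hk hb
      · rw [union_comm]
        exact h.symm.five_le_ncard_of_inr_mem hk hb
    · exact h.five_le_ncard_of_inr_notMem hk (not_exists.1 hpole)

theorem not_srStep_of_forall_two_lt_ncard {G : FinGraph}
    (h : ∀ x u, G.graph.Adj x u → 2 < (G.graph.commonNeighbors x u).ncard) (H : FinGraph) :
    ¬ SRStep G H := by
  rintro ⟨x, y, hxy, ⟨h₁, h₅, h₀⟩, -⟩
  have hsub : G.graph.commonNeighbors x (y 3) ⊆ {y 2, y 4} := by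
    rintro _ ⟨hx, hy⟩
    rw [hxy.neighbors] at hx
    obtain ⟨i, rfl⟩ := hx
    replace hy := SimpleGraph.Adj.symm hy
    fin_cases i
    exacts [(h₀ hy).elim, (h₁ hy).elim, .inl rfl, (G.graph.irrefl hy).elim, .inr rfl,
      (h₅ hy).elim]
  have hpair : ({y 2, y 4} : Set G.V).ncard = 2 := ncard_pair (hxy.injective.ne (by decide))
  exact (h x _ (hxy.adj 3)).not_ge (hpair ▸ ncard_le_ncard hsub)

theorem not_crStep_of_forall_adj {G : FinGraph} {p q : G.V}
    (hp : ∀ v, v ≠ p → v ≠ q → G.graph.Adj p v) (hq : ∀ v, v ≠ p → v ≠ q → G.graph.Adj q v)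
    (H : FinGraph) : ¬ CRStep G H := by
  rintro ⟨x, v, hxv, ⟨h₀₂, h₁₃⟩, -⟩
  have inner_ne_outer (i j) : x i ≠ v j := fun h =>
    Set.disjoint_left.1 hxv.disjoint (mem_range_self i) (h ▸ mem_range_self j)
  have hopp (i : Fin 4) : i + 2 ≠ i := by revert i; decide
  have hopp' (i : Fin 4) : i + 2 + 2 = i := by revert i; decide
  have not_adj_outer (i) : ¬ G.graph.Adj (v i) (v (i + 2)) := by
    fin_cases i
    exacts [h₀₂, h₁₃, fun h => h₀₂ h.symm, fun h => h₁₃ h.symm]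
  have not_adj_inner_outer (i) : ¬ G.graph.Adj (x i) (v (i + 2)) := by
    rw [← SimpleGraph.mem_neighborSet, hxv.neighbors]
    have hoff : i + 2 ≠ i - 1 ∧ i + 2 ≠ i ∧ i + 2 ≠ i + 1 := by revert i; decide
    simp [(inner_ne_outer _ _).symm, hxv.injective_outer.eq_iff, hoff]
  have adj_of_ne (a) (ha : a = p ∨ a = q) (w) (hwp : w ≠ p) (hwq : w ≠ q) : G.graph.Adj a w := by
    rcases ha with rfl | rfl
    exacts [hp w hwp hwq, hq w hwp hwq]
  have outer_ne (i) : ¬ (v i = p ∨ v i = q) := by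
    intro hi
    have h₁ : ¬ G.graph.Adj (v i) (x (i + 2)) := fun h =>
      not_adj_inner_outer (i + 2) (by rw [hopp']; exact h.symm)
    have h₂ : v (i + 2) ≠ v i := hxv.injective_outer.ne (hopp i)
    grind
  have inner_ne (i) : ¬ (x i = p ∨ x i = q) := by
    intro hi
    obtain ⟨h₁, h₂⟩ := not_or.1 (outer_ne (i + 2))
    exact not_adj_inner_outer i (adj_of_ne _ hi _ h₁ h₂)
  obtain ⟨h₁, h₂⟩ := not_or.1 (inner_ne 0)
  have hmem : p ∈ G.graph.neighborSet (x 0) := (hp _ h₁ h₂).symm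
  rw [hxv.neighbors] at hmem
  grind

theorem extendedWheelGraph_adj_induction [NeZero k]
    {P : Fin (2 * k) ⊕ Bool → Fin (2 * k) ⊕ Bool → Prop} (symm : ∀ u v, P u v → P v u)
    (rim_rim : ∀ d j, j = 1 ∨ j = 2 → P (rim k d) (rim k (d + j)))
    (rim_pole : ∀ d b, P (rim k d) (.inr b)) {u v : Fin (2 * k) ⊕ Bool}
    (huv : (extendedWheelGraph k).Adj u v) : P u v := by
  have inl_inl (i j : Fin (2 * k)) (hij : j.val = (i.val + 1) % (2 * k) ∨
      j.val = (i.val + 2) % (2 * k)) : P (.inl i) (.inl j) := by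
    rw [← rim_val i]
    rcases hij with hij | hij
    · exact (congrArg Sum.inl (Fin.ext hij) : .inl j = rim k (i + 1)) ▸ rim_rim i 1 (.inl rfl)
    · exact (congrArg Sum.inl (Fin.ext hij) : .inl j = rim k (i + 2)) ▸ rim_rim i 2 (.inr rfl)
  rcases u with i | b <;> rcases v with j | c
  · exact (extendedWheelGraph_adj_inl_inl.1 huv).2.elim (inl_inl i j) (symm _ _ <| inl_inl j i ·)
  · exact rim_val i ▸ rim_pole i c
  · exact symm _ _ (rim_val j ▸ rim_pole j b)
  · exact (not_extendedWheelGraph_adj_inr_inr b c huv).elim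

theorem two_lt_ncard_commonNeighbors_XW (hk : 3 ≤ k) {u v : Fin (2 * k) ⊕ Bool}
    (huv : (extendedWheelGraph k).Adj u v) :
    2 < ((extendedWheelGraph k).commonNeighbors u v).ncard := by
  have : NeZero k := ⟨by omega⟩
  have hadj₁ (d) := extendedWheelGraph_adj_rim_add hk d (.inl rfl)
  have hadj₂ (d) := extendedWheelGraph_adj_rim_add hk d (.inr rfl)
  have hpole := extendedWheelGraph_adj_rim_inr (k := k)
  refine extendedWheelGraph_adj_induction
    (P := fun u v => 2 < ((extendedWheelGraph k).commonNeighbors u v).ncard)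
    (fun u v h => ?_) (fun d j hj => ?_) (fun d b => ?_) huv
  · rwa [SimpleGraph.commonNeighbors_symm]
  · obtain ⟨e, he⟩ : ∃ e, rim k e ∈
        (extendedWheelGraph k).commonNeighbors (rim k d) (rim k (d + j)) := by
      rcases hj with rfl | rfl
      exacts [⟨d + 2, hadj₂ d, hadj₁ (d + 1)⟩, ⟨d + 1, hadj₁ d, (hadj₁ (d + 1)).symm⟩]
    exact (two_lt_ncard (toFinite _)).2 ⟨.inr false, ⟨hpole d _, hpole (d + j) _⟩, .inr true,
      ⟨hpole d _, hpole (d + j) _⟩, rim k e, he, by simp, Sum.inr_ne_inl, Sum.inr_ne_inl⟩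
  · obtain ⟨e, he⟩ : ∃ e, rim k (e + 1) = rim k d :=
      ⟨d + (2 * k - 1), rim_eq_rim_iff.2 (by
        rw [add_assoc, Nat.sub_add_cancel (by omega)]; exact Nat.add_modEq_right ..)⟩
    rw [← he]
    exact (two_lt_ncard (toFinite _)).2 ⟨rim k e, ⟨(hadj₁ e).symm, (hpole e b).symm⟩,
      rim k (e + 2), ⟨hadj₁ (e + 1), (hpole (e + 2) b).symm⟩,
      rim k (e + 3), ⟨hadj₂ (e + 1), (hpole (e + 3) b).symm⟩,
      rim_ne_rim_add e two_ne_zero (by omega), rim_ne_rim_add e three_ne_zero (by omega),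
      rim_ne_rim_add (e + 2) one_ne_zero (by omega)⟩

theorem isIrreducible_XW (hk : 3 ≤ k) : IsIrreducible SRCRStep (XW k) := by
  have pole_adj (b : Bool) (v : Fin (2 * k) ⊕ Bool) (hf : v ≠ .inr false) (ht : v ≠ .inr true) :
      (extendedWheelGraph k).Adj (.inr b) v := by
    rcases v with i | _ | _
    exacts [(extendedWheelGraph_adj_inl_inr i b).symm, (hf rfl).elim, (ht rfl).elim]
  exact fun H h => h.elim
    (not_srStep_of_forall_two_lt_ncard (fun _ _ => two_lt_ncard_commonNeighbors_XW hk) H)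
    (not_crStep_of_forall_adj (pole_adj false) (pole_adj true) H)

theorem XW_iso_iff {k l : ℕ} : (XW k).Iso (XW l) ↔ k = l := by
  refine ⟨fun ⟨φ⟩ => ?_, ?_⟩
  · have := Nat.card_congr φ.toEquiv
    simp only [XW, Nat.card_eq_fintype_card, Fintype.card_sum, Fintype.card_fin,
      Fintype.card_bool] at this
    omega
  · rintro rfl
    exact ⟨SimpleGraph.Iso.refl⟩

end ExtendedWheels

section Reductions

theorem srStep_of_injective {V W : Type} [Finite V] [Finite W] {G : SimpleGraph V}
    {H : SimpleGraph W} {x : V} {y : Fin 6 → V} (f : W → V) (hxy : IsCrossedStar G x y)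
    (hy : SRFeasible G y) (hf : Function.Injective f) (hrange : ∀ v, v ≠ x ↔ ∃ w, f w = v)
    (hadj : ∀ a b, ((G \ SimpleGraph.edge (y 2) (y 4)) ⊔ SimpleGraph.edge (y 3) (y 0) ⊔
      SimpleGraph.edge (y 3) (y 1) ⊔ SimpleGraph.edge (y 3) (y 5)).Adj (f a) (f b) ↔ H.Adj a b) :
    SRStep ⟨V, inferInstance, G⟩ ⟨W, inferInstance, H⟩ :=
  let φ : W ≃ ↥({x}ᶜ : Set V) := (Equiv.ofInjective f hf).trans
    (Equiv.setCongr (Set.ext fun v => (hrange v).symm))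
  ⟨x, y, hxy, hy, ⟨⟨φ, hadj _ _⟩⟩⟩

/-- Mathlib's instance is a cast along an equation of propositions, on which `decide` gets stuck. -/
instance decidableRelEdgeAdj {V : Type} [DecidableEq V] (s t : V) :
    DecidableRel (SimpleGraph.edge s t).Adj :=
  fun _ _ => decidable_of_iff _ (SimpleGraph.edge_adj ..).symm

theorem isCrossedStar_iff {V : Type} {G : SimpleGraph V} {x : V} {y : Fin 6 → V} :
    IsCrossedStar G x y ↔ Function.Injective y ∧ (∀ v, G.Adj x v ↔ ∃ i, y i = v) ∧
      (∀ i, G.Adj (y i) (y (i + 1))) ∧ G.Adj (y 0) (y 2) ∧ G.Adj (y 2) (y 4) ∧ G.Adj (y 4) (y 0) :=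
  ⟨fun h => ⟨h.injective, fun v => Set.ext_iff.1 h.neighbors v, h.hexagon, h.triangle⟩,
    fun ⟨hinj, hnbr, hhex, htri⟩ => ⟨hinj, Set.ext hnbr, hhex, htri⟩⟩

instance {V : Type} [Fintype V] [DecidableEq V] (G : SimpleGraph V) [DecidableRel G.Adj] (x : V)
    (y : Fin 6 → V) : Decidable (IsCrossedStar G x y) :=
  decidable_of_iff _ isCrossedStar_iff.symm

instance {V : Type} (G : SimpleGraph V) [DecidableRel G.Adj] (y : Fin 6 → V) :
    Decidable (SRFeasible G y) :=
  inferInstanceAs (Decidable (_ ∧ _))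

theorem IsIrreducible.eq_of_reflTransGen {C : FinGraph → Prop} {step : FinGraph → FinGraph → Prop}
    {G H : FinGraph} (hG : IsIrreducible step G)
    (h : Relation.ReflTransGen (stepOn C step) G H) : G = H := by
  rcases h.cases_head with h | ⟨K, hK, -⟩
  exacts [h, (hG K hK.2.2).elim]

theorem not_isConfluent {C : FinGraph → Prop} {step : FinGraph → FinGraph → Prop}
    {G U W : FinGraph} (hU : IsIrreducible step U) (hW : IsIrreducible step W)
    (hGU : Relation.ReflTransGen (stepOn C step) G U)
    (hGW : Relation.ReflTransGen (stepOn C step) G W) (hUW : ¬ U.Iso W) :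
    ¬ IsConfluent (stepOn C step) := by
  intro h
  obtain ⟨Z, Z', hZ, hZ', hiso⟩ := h G U W hGU hGW
  rw [← hU.eq_of_reflTransGen hZ, ← hW.eq_of_reflTransGen hZ'] at hiso
  exact hUW hiso

end Reductions

section Counterexample

/-- An eleven-vertex graph that reduces to `XW_8`; the vertices `0, …, 7` form the cycle of `XW_8`
and the vertices `8` and `9` are its poles. -/
def splitElevenKites : List (Kite (Fin 11)) :=
  [(1, 0, 7, 9), (1, 0, 10, 2), (2, 1, 9, 3), (3, 2, 8, 4), (4, 3, 9, 5), (5, 4, 8, 6),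
    (6, 5, 9, 7), (7, 0, 10, 6), (8, 2, 10, 6)]

/-- A twelve-vertex graph that reduces to the graph of `splitElevenKites` on `0, …, 10`. -/
def splitTwelveKites : List (Kite (Fin 12)) :=
  [(1, 0, 7, 9), (1, 0, 10, 2), (2, 1, 11, 3), (3, 2, 8, 4), (4, 3, 11, 5), (5, 4, 8, 6),
    (6, 5, 9, 7), (7, 0, 10, 6), (8, 2, 10, 6), (9, 1, 11, 5)]

/-- The common ancestor of `XW_8` and `XW_{10}`. -/
def splitThirteenKites : List (Kite (Fin 13)) :=
  [(1, 0, 7, 9), (1, 0, 10, 2), (2, 1, 12, 8), (4, 3, 11, 5), (4, 3, 12, 8), (5, 4, 8, 6),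
    (6, 5, 9, 7), (7, 0, 10, 6), (8, 2, 10, 6), (9, 1, 11, 5), (11, 1, 12, 3)]

/-- The union of the kites in a list as a finite graph. -/
def kiteFinGraph {n : ℕ} (Ks : List (Kite (Fin n))) : FinGraph :=
  ⟨Fin n, inferInstance, kiteGraph Ks⟩

/-- The kites of `XW_{2k}`: the two poles alternate along the cycle. -/
def wheelKites (k : ℕ) [NeZero k] : List (Kite (Fin (2 * k) ⊕ Bool)) :=
  (List.range (2 * k)).map fun d =>
    (rim k (d + 1), rim k d, .inr (decide (Odd d)), rim k (d + 2))

/-- The numbering of the vertices of `XW_{2k}` used in the coordinate tables: first the cycle, then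
the two poles. -/
def wheelIndex (k : ℕ) : Fin (2 * k) ⊕ Bool → Fin (2 * k + 2)
  | .inl i => i.castAdd 2
  | .inr b => .natAdd (2 * k) (if b then 1 else 0)

theorem isOptimalOnePlanar_XW_four : IsOptimalOnePlanar (XW 4) := by
  let : LinearOrder (Fin (2 * 4) ⊕ Bool) := LinearOrder.lift' toLex toLex.injective
  let pos := ![(-1, -6), (0, -8), (-8, 0), (0, 8), (3, 3), (4, 2), (-3, -1), (3, -2), (-5, -1),
    (8, 0)] ∘ wheelIndex 4
  exact isOptimalOnePlanar_of_le_kiteGraph (G := extendedWheelGraph 4) (Ks := wheelKites 4)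
    (D := outerKiteLayout pos (rim 4 2, rim 4 1, .inr true, rim 4 3))
    (show ∀ a b, (extendedWheelGraph 4).Adj a b → _ by decide +kernel) (by decide +kernel)
    (by decide) (by decide +kernel)

theorem isOptimalOnePlanar_XW_five : IsOptimalOnePlanar (XW 5) := by
  let : LinearOrder (Fin (2 * 5) ⊕ Bool) := LinearOrder.lift' toLex toLex.injective
  let pos := ![(5, -2), (2, -5), (0, -8), (-8, 0), (0, 8), (1, 5), (3, 3), (1, 2), (4, 1), (3, 1),
    (8, 0), (-4, 2)] ∘ wheelIndex 5
  exact isOptimalOnePlanar_of_le_kiteGraph (G := extendedWheelGraph 5) (Ks := wheelKites 5)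
    (D := outerKiteLayout pos (rim 5 3, rim 5 2, .inr false, rim 5 4))
    (show ∀ a b, (extendedWheelGraph 5).Adj a b → _ by decide +kernel) (by decide +kernel)
    (by decide) (by decide +kernel)

theorem isOptimalOnePlanar_splitEleven : IsOptimalOnePlanar (kiteFinGraph splitElevenKites) :=
  isOptimalOnePlanar_of_le_kiteGraph le_rfl
    (D := outerKiteLayout ![(2, -3), (0, -8), (-8, 0), (0, 8), (1, 4), (4, 1), (3, 1), (5, -1),
      (-1, 2), (8, 0), (-1, -1)] (2, 1, 9, 3))
    (by decide +kernel) (by decide) (by decide +kernel)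

theorem isOptimalOnePlanar_splitTwelve : IsOptimalOnePlanar (kiteFinGraph splitTwelveKites) :=
  isOptimalOnePlanar_of_le_kiteGraph le_rfl
    (D := outerKiteLayout ![(-1, -4), (0, -8), (-8, 0), (0, 8), (1, 3), (4, 1), (-2, -1), (-1, -3),
      (-2, 1), (1, -3), (-4, -2), (8, 0)] (2, 1, 11, 3))
    (by decide +kernel) (by decide) (by decide +kernel)

theorem isOptimalOnePlanar_splitThirteen : IsOptimalOnePlanar (kiteFinGraph splitThirteenKites) :=
  isOptimalOnePlanar_of_le_kiteGraph le_rfl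
    (D := outerKiteLayout ![(-4, -2), (0, -8), (-1, -1), (4, -1), (2, 1), (0, 8), (-2, 4), (-5, -1),
      (-1, 2), (-8, 0), (-2, 1), (8, 0), (2, -3)] (9, 1, 11, 5))
    (by decide +kernel) (by decide) (by decide +kernel)

section SRSteps

set_option synthInstance.maxSize 512

theorem srStep_splitThirteen_splitTwelve :
    SRStep (kiteFinGraph splitThirteenKites) (kiteFinGraph splitTwelveKites) :=
  srStep_of_injective (G := kiteGraph splitThirteenKites) (x := 12) (y := ![3, 4, 8, 2, 1, 11])
    Fin.castSucc (by decide +kernel) (by decide) (by decide) (by decide) (by decide +kernel)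

theorem srStep_splitTwelve_splitEleven :
    SRStep (kiteFinGraph splitTwelveKites) (kiteFinGraph splitElevenKites) :=
  srStep_of_injective (G := kiteGraph splitTwelveKites) (x := 11) (y := ![3, 2, 1, 9, 5, 4])
    Fin.castSucc (by decide +kernel) (by decide) (by decide) (by decide) (by decide +kernel)

theorem srStep_splitEleven_XW_four : SRStep (kiteFinGraph splitElevenKites) (XW 4) :=
  srStep_of_injective (G := kiteGraph splitElevenKites) (x := 10) (y := ![0, 1, 2, 8, 6, 7])
    (Fin.castSucc ∘ wheelIndex 4) (by decide +kernel) (by decide) (by decide) (by decide +kernel)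
    (by decide +kernel)

theorem srStep_splitThirteen_XW_five : SRStep (kiteFinGraph splitThirteenKites) (XW 5) :=
  srStep_of_injective (G := kiteGraph splitThirteenKites) (x := 4) (y := ![3, 11, 5, 6, 8, 12])
    (![0, 7, 9, 5, 11, 3, 12, 8, 2, 10, 1, 6] ∘ wheelIndex 5) (by decide +kernel) (by decide)
    (by decide +kernel) (by decide +kernel) (by decide +kernel)

end SRSteps

theorem isFiveConnectedOptimal_XW_four : IsFiveConnectedOptimal (XW 4) :=
  ⟨isOptimalOnePlanar_XW_four, isVertexConnected_XW (by decide)⟩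

theorem isFiveConnectedOptimal_XW_five : IsFiveConnectedOptimal (XW 5) :=
  ⟨isOptimalOnePlanar_XW_five, isVertexConnected_XW (by decide)⟩

theorem isFiveConnectedOptimal_of_srStep {n : ℕ} {Ks : List (Kite (Fin n))} {H : FinGraph}
    (hKs : IsOptimalOnePlanar (kiteFinGraph Ks)) (hdeg : ∀ v, 5 ≤ (kiteGraph Ks).degree v)
    (hH : IsFiveConnectedOptimal H) (h : SRStep (kiteFinGraph Ks) H) :
    IsFiveConnectedOptimal (kiteFinGraph Ks) :=
  ⟨hKs, hH.2.of_srStep h fun (v : Fin n) => by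
    change 5 ≤ ((kiteGraph Ks).neighborSet v).ncard
    rw [← SimpleGraph.coe_neighborFinset, ncard_coe_finset]
    exact hdeg v⟩

theorem isFiveConnectedOptimal_splitEleven :
    IsFiveConnectedOptimal (kiteFinGraph splitElevenKites) :=
  isFiveConnectedOptimal_of_srStep isOptimalOnePlanar_splitEleven (by decide +kernel)
    isFiveConnectedOptimal_XW_four srStep_splitEleven_XW_four

theorem isFiveConnectedOptimal_splitTwelve :
    IsFiveConnectedOptimal (kiteFinGraph splitTwelveKites) :=
  isFiveConnectedOptimal_of_srStep isOptimalOnePlanar_splitTwelve (by decide +kernel)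
    isFiveConnectedOptimal_splitEleven srStep_splitTwelve_splitEleven

theorem isFiveConnectedOptimal_splitThirteen :
    IsFiveConnectedOptimal (kiteFinGraph splitThirteenKites) :=
  isFiveConnectedOptimal_of_srStep isOptimalOnePlanar_splitThirteen (by decide +kernel)
    isFiveConnectedOptimal_splitTwelve srStep_splitThirteen_splitTwelve

theorem reflTransGen_splitThirteen_XW {m : ℕ} (hm : m = 4 ∨ m = 5) :
    Relation.ReflTransGen (stepOn IsFiveConnectedOptimal SRStep)
      (kiteFinGraph splitThirteenKites) (XW m) := by
  rcases hm with rfl | rfl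
  · exact ((Relation.ReflTransGen.single ⟨isFiveConnectedOptimal_splitThirteen,
      isFiveConnectedOptimal_splitTwelve, srStep_splitThirteen_splitTwelve⟩).tail
      ⟨isFiveConnectedOptimal_splitTwelve, isFiveConnectedOptimal_splitEleven,
        srStep_splitTwelve_splitEleven⟩).tail
      ⟨isFiveConnectedOptimal_splitEleven, isFiveConnectedOptimal_XW_four,
        srStep_splitEleven_XW_four⟩
  · exact .single ⟨isFiveConnectedOptimal_splitThirteen, isFiveConnectedOptimal_XW_five,
      srStep_splitThirteen_XW_five⟩

theorem reflTransGen_stepOn_isOptimalOnePlanar {G H : FinGraph}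
    (h : Relation.ReflTransGen (stepOn IsFiveConnectedOptimal SRStep) G H) :
    Relation.ReflTransGen (stepOn IsOptimalOnePlanar SRCRStep) G H :=
  Relation.ReflTransGen.mono (fun _ _ ⟨hG, hH, hstep⟩ => ⟨hG.1, hH.1, .inl hstep⟩) _ _ h

end Counterexample

end OnePlanarReduction

open OnePlanarReduction

theorem mainTheorem10 :
    -- the system with both rules on the optimal 1-planar graphs is not confluent
    (¬ OnePlanarReduction.IsConfluent
        (OnePlanarReduction.stepOn OnePlanarReduction.IsOptimalOnePlanar
          OnePlanarReduction.SRCRStep)) ∧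
    -- the system with `SR` alone on the 5-connected optimal 1-planar graphs is not confluent
    (¬ OnePlanarReduction.IsConfluent
        (OnePlanarReduction.stepOn OnePlanarReduction.IsFiveConnectedOptimal
          OnePlanarReduction.SRStep)) ∧
    -- reductions of one graph to two different irreducible extended wheel graphs, for both rules
    (∃ G : OnePlanarReduction.FinGraph, OnePlanarReduction.IsOptimalOnePlanar G ∧
      ∃ k l : ℕ, 3 ≤ k ∧ 3 ≤ l ∧
        ¬ (OnePlanarReduction.XW k).Iso (OnePlanarReduction.XW l) ∧
        (∀ m : ℕ, m = k ∨ m = l →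
          Relation.ReflTransGen
            (OnePlanarReduction.stepOn OnePlanarReduction.IsOptimalOnePlanar
              OnePlanarReduction.SRCRStep) G (OnePlanarReduction.XW m) ∧
          OnePlanarReduction.IsIrreducible OnePlanarReduction.SRCRStep
            (OnePlanarReduction.XW m))) ∧
    -- the same for `SR` alone on 5-connected graphs
    (∃ G : OnePlanarReduction.FinGraph, OnePlanarReduction.IsFiveConnectedOptimal G ∧
      ∃ k l : ℕ, 3 ≤ k ∧ 3 ≤ l ∧
        ¬ (OnePlanarReduction.XW k).Iso (OnePlanarReduction.XW l) ∧
        (∀ m : ℕ, m = k ∨ m = l →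
          Relation.ReflTransGen
            (OnePlanarReduction.stepOn OnePlanarReduction.IsFiveConnectedOptimal
              OnePlanarReduction.SRStep) G (OnePlanarReduction.XW m) ∧
          OnePlanarReduction.IsIrreducible OnePlanarReduction.SRStep
            (OnePlanarReduction.XW m))) := by
  have hne : ¬ (XW 4).Iso (XW 5) := by rw [XW_iso_iff]; decide
  have hirr (m : ℕ) (hm : m = 4 ∨ m = 5) : IsIrreducible SRCRStep (XW m) :=
    isIrreducible_XW (by omega)
  have hirrSR (m : ℕ) (hm : m = 4 ∨ m = 5) : IsIrreducible SRStep (XW m) :=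
    fun H h => hirr m hm H (.inl h)
  have hred (m : ℕ) (hm : m = 4 ∨ m = 5) :
      Relation.ReflTransGen (stepOn IsOptimalOnePlanar SRCRStep)
        (kiteFinGraph splitThirteenKites) (XW m) :=
    reflTransGen_stepOn_isOptimalOnePlanar (reflTransGen_splitThirteen_XW hm)
  refine ⟨?_, ?_, ?_, ?_⟩
  · exact not_isConfluent (hirr 4 (.inl rfl)) (hirr 5 (.inr rfl)) (hred 4 (.inl rfl))
      (hred 5 (.inr rfl)) hne
  · exact not_isConfluent (hirrSR 4 (.inl rfl)) (hirrSR 5 (.inr rfl))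
      (reflTransGen_splitThirteen_XW (.inl rfl)) (reflTransGen_splitThirteen_XW (.inr rfl)) hne
  · exact ⟨_, isFiveConnectedOptimal_splitThirteen.1, 4, 5, by decide, by decide, hne,
      fun m hm => ⟨hred m hm, hirr m hm⟩⟩
  · exact ⟨_, isFiveConnectedOptimal_splitThirteen, 4, 5, by decide, by decide, hne,
      fun m hm => ⟨reflTransGen_splitThirteen_XW hm, hirrSR m hm⟩⟩
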